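/- Let $\mathbb S^1=\{z\in\mathbb C:|z|=1\}$, let $1\le m<n$ be integers, and let $Z_n=\{\zeta_1,\dots,\zeta_n\}$ and $Z_m=\{\xi_1,\dots,\xi_m\}$ be sets of $n$ and $m$ points of $\mathbb S^1$, all $n+m$ points being distinct (so that $Z_n\cap Z_m=\emptyset$). For a finite positive Borel measure $\nu$ on $\mathbb S^1$ with infinite support, let $\{\Phi_k\}_{k\ge 0}$ be its sequence of monic orthogonal polynomials, that is, $\Phi_k$ is monic of degree $k$ and $\int \Phi_j\overline{\Phi_k}\,d\nu=0$ for $j\ne k$. Put $\Phi_k^*(z)=z^k\,\overline{\Phi_k(1/\overline z)}$, and for $\ell\ge 1$ and $b\in\mathbb S^1$ define the paraorthogonal polynomial $$\Psi_\ell(z;\nu,b)=z\,\Phi_{\ell-1}(z)-\overline b\,\Phi_{\ell-1}^*(z).$$ Say that $Z_m$ strictly interlaces $Z_n$ if $Z_n\cap Z_m=\emptyset$ and, for every pair of counterclockwise consecutive points of $Z_n$, the open counterclockwise arc from the first to the second contains at most one point of $Z_m$ (equivalently: when $\zeta_1,\dots,\zeta_n$ are listed in counterclockwise order and $\zeta_{n+1}=\zeta_1$,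 for every $k=1,\dots,n$ the open counterclockwise arc from $\zeta_k$ to $\zeta_{k+1}$ contains at most one point of $Z_m$). Then there exist a finite positive Borel measure $\nu$ on $\mathbb S^1$ with infinite support and parameters $b_n,b_m\in\mathbb S^1$ such that the zero sets in $\mathbb C$ satisfy $$\{z:\Psi_n(z;\nu,b_n)=0\}=Z_n,\qquad \{z:\Psi_m(z;\nu,b_m)=0\}=Z_m$$ if and only if $Z_m$ strictly interlaces $Z_n$. -/

import Mathlib

open MeasureTheory Polynomial

noncomputable section

/-- The unit circle carries its Borel `σ`-algebra. -/
instance instMeasurableSpaceUnitCircle : MeasurableSpace Circle := borel Circle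

instance instBorelSpaceUnitCircle : BorelSpace Circle := ⟨rfl⟩

/-- The reversed polynomial of `p` at degree `k`, `p^*(z) = z ^ k * conj (p (1 / conj z))`, that is,
the coefficients `c 0, …, c k` of `p` are conjugated and put in the opposite order. -/
def reversedPoly (k : ℕ) (p : ℂ[X]) : ℂ[X] :=
  (p.map (starRingEnd ℂ)).reflect k

theorem reversedPoly_eval (k : ℕ) (p : ℂ[X]) (hp : p.natDegree ≤ k) (z : ℂ) (hz : z ≠ 0) :
    (reversedPoly k p).eval z
      = z ^ k * (starRingEnd ℂ) (p.eval (1 / (starRingEnd ℂ) z)) := by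
  have h1 : (starRingEnd ℂ) (p.eval (1 / (starRingEnd ℂ) z))
      = (p.map (starRingEnd ℂ)).eval z⁻¹ := by
    have h := Polynomial.hom_eval₂ p (RingHom.id ℂ) (starRingEnd ℂ) (1 / (starRingEnd ℂ) z)
    simpa [Polynomial.eval_map, Polynomial.eval₂_id] using h
  have h2 : (p.map (starRingEnd ℂ)).natDegree ≤ k := le_trans natDegree_map_le hp
  let _ : Invertible z⁻¹ := invertibleOfNonzero (inv_ne_zero hz)
  have h3 := Polynomial.eval₂_reflect_mul_pow (RingHom.id ℂ) z⁻¹ k (p.map (starRingEnd ℂ)) h2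
  simp only [invOf_eq_inv, inv_inv, Polynomial.eval₂_id, inv_pow] at h3
  rw [h1, ← h3, reversedPoly]
  field_simp

/-- `Φ` is the sequence of monic orthogonal polynomials on the unit circle (OPUC) of the measure
`ν`: `Φ k` is monic of degree `k`, and the `Φ k` are pairwise orthogonal in `L²(ν)`. -/
structure IsMonicOPUC (ν : Measure Circle) (Φ : ℕ → ℂ[X]) : Prop where
  monic : ∀ k, (Φ k).Monic
  natDegree_eq : ∀ k, (Φ k).natDegree = k
  orthogonal : ∀ j k, j ≠ k →
    ∫ z : Circle, (Φ j).eval (z : ℂ) * (starRingEnd ℂ) ((Φ k).eval (z : ℂ)) ∂ν = 0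

/-- The paraorthogonal polynomial (POPUC) of degree `n ≥ 1` with boundary parameter `b`,
`Ψ_n(z) = z Φ_{n-1}(z) - conj b * Φ_{n-1}^*(z)`, built from the monic OPUC `Φ`. -/
def popuc (Φ : ℕ → ℂ[X]) (n : ℕ) (b : Circle) : ℂ[X] :=
  X * Φ (n - 1) - C ((starRingEnd ℂ) (b : ℂ)) * reversedPoly (n - 1) (Φ (n - 1))

/-- The zero set of a complex polynomial. -/
def zeroSet (p : ℂ[X]) : Set ℂ := {z | p.eval z = 0}

/-- The open counterclockwise arc of the unit circle from `a` to `b`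
(the circle without `a`, if `b = a`). -/
def ccwArc (a b : Circle) : Set Circle :=
  {z | ∃ s t : ℝ, 0 < s ∧ s < t ∧ t ≤ 2 * Real.pi ∧
    z = a * Circle.exp s ∧ b = a * Circle.exp t}

/-- `b` is the counterclockwise successor of `a` among the points of `Z`. -/
def IsCcwSucc (Z : Finset Circle) (a b : Circle) : Prop :=
  a ∈ Z ∧ b ∈ Z ∧ ∀ z ∈ Z, z ∉ ccwArc a b

/-- `Y` strictly interlaces `Z`: the sets are disjoint, and each of the open arcs between
counterclockwise consecutive points of `Z` contains at most one point of `Y`. -/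
def StrictlyInterlaces (Y Z : Finset Circle) : Prop :=
  Disjoint Y Z ∧
    ∀ a b : Circle, IsCcwSucc Z a b →
      ∀ y ∈ Y, ∀ y' ∈ Y, y ∈ ccwArc a b → y' ∈ ccwArc a b → y = y'

end

/-!
For a measure `ν` of infinite support, write `⟨p, q⟩ = ∫ p conj(q) dν`. The paraorthogonal polynomial
`Ψ_l` is monic of degree `l` and orthogonal to `z, …, z ^ (l - 1)`. Conversely, a monic polynomial `P` of
degree `l` with constant coefficient of modulus one and with these orthogonality relations is
`z Φ_{l-1} + P(0) Φ_{l-1}^*`, hence a paraorthogonal polynomial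
(`IsParaorthogonal.exists_popuc_eq`). So the question is for which pairs of sets there is a measure
`ν` such that the nodal polynomials of both sets have these relations. The advantage of this form is
that the relations are linear in `ν`.

*Necessity.* The orthogonality relations of `Ψ_n` give a quadrature formula with positive weights at
the points of `Z_n` (`IsParaorthogonal.circleInner_eq_sum`). If two points `y`, `y'` of `Z_m` lie in
the same arc of `Z_n`, test `Ψ_m` against `z q`, where `q = Ψ_m / ((z - y) (z - y'))`. The result is
zero by orthogonality. By quadrature it is a sum over `Z_n` of terms that are all positive multiples
of the same number, since `(z - y) (z - y') / z` has constant argument on the part of the circle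
outside the arc from `y` to `y'` (`exists_sub_mul_sub_eq`). This is a contradiction.

*Sufficiency.* One point in each gap of a set `S` of the circle determines, through the vanishing of a
divided difference, positive weights for which the nodal polynomial of `S` has the orthogonality
relations (`exists_pos_weights`). If `Z_m` strictly interlaces `Z_n`, then every gap of `Z_m` contains
a point of `Z_n`, and adding up over the choices of such points gives positive weights on the whole of
`Z_n` that are good for `Z_m`; they are trivially good for `Z_n`. This measure has finite support.
To repair this, let `σ` be a measure of infinite support that is good for `Z_n`, an infinite sum of
discrete measures on slightly rotated copies of `Z_n`. It agrees with its quadrature measure on `Z_n`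
for all products `p conj(q)` of degrees less than `n`, so a large multiple of the discrete measure,
plus `σ`, minus the quadrature measure of `σ`, is positive, of infinite support, and good for both
sets. The orthogonal polynomials of this measure are produced by the Gram-Schmidt recursion.
-/

open scoped Classical

/-! ### Counterclockwise angles -/

/-- The counterclockwise angle from `a` to `b`, normalised to lie in `(0, 2π]`; in particular the
angle from a point to itself is `2π`, in accordance with the convention for `ccwArc a a`. -/
noncomputable def ccwAngle (a b : Circle) : ℝ :=
  toIocMod Real.two_pi_pos 0 (Complex.arg ((b / a : Circle) : ℂ))

theorem ccwAngle_pos (a b : Circle) : 0 < ccwAngle a b :=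
  left_lt_toIocMod _ _ _

theorem ccwAngle_le (a b : Circle) : ccwAngle a b ≤ 2 * Real.pi :=
  (toIocMod_le_right _ _ _).trans_eq (zero_add _)

theorem mul_exp_ccwAngle (a b : Circle) : a * Circle.exp (ccwAngle a b) = b := by
  have h := toIocMod_add_toIocDiv_zsmul Real.two_pi_pos 0 (Complex.arg ((b / a : Circle) : ℂ))
  have h2 : Circle.exp (ccwAngle a b) = b / a := by
    rw [← Circle.exp_arg (b / a), Circle.exp_eq_exp]
    refine ⟨-toIocDiv Real.two_pi_pos 0 (Complex.arg ((b / a : Circle) : ℂ)), ?_⟩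
    rw [zsmul_eq_mul] at h
    rw [ccwAngle, Int.cast_neg]
    linarith
  rw [h2, mul_div_cancel]

theorem ccwAngle_mul_exp (a : Circle) {t : ℝ} (h0 : 0 < t) (h1 : t ≤ 2 * Real.pi) :
    ccwAngle a (a * Circle.exp t) = t := by
  have h := mul_exp_ccwAngle a (a * Circle.exp t)
  obtain ⟨k, hk⟩ := Circle.exp_eq_exp.1 (mul_left_cancel h)
  have h2 := ccwAngle_pos a (a * Circle.exp t)
  have h3 := ccwAngle_le a (a * Circle.exp t)
  have hp := Real.two_pi_pos
  have hk1 : (k : ℝ) < 1 := by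
    by_contra! hc
    nlinarith
  have hk2 : (-1 : ℝ) < k := by
    by_contra! hc
    nlinarith
  have : k = 0 := by
    have a1 : k < 1 := by exact_mod_cast hk1
    have a2 : -1 < k := by exact_mod_cast hk2
    omega
  rw [hk, this]
  simp

theorem ccwAngle_inj {a b c : Circle} (h : ccwAngle a b = ccwAngle a c) : b = c := by
  rw [← mul_exp_ccwAngle a b, h, mul_exp_ccwAngle]

theorem mem_ccwArc_iff {a b z : Circle} : z ∈ ccwArc a b ↔ ccwAngle a z < ccwAngle a b := by
  constructor
  · rintro ⟨s, t, hs, hst, ht, rfl, rfl⟩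
    rwa [ccwAngle_mul_exp a hs (by linarith), ccwAngle_mul_exp a (by linarith) ht]
  · intro h
    exact ⟨_, _, ccwAngle_pos a z, h, ccwAngle_le a b, (mul_exp_ccwAngle a z).symm,
      (mul_exp_ccwAngle a b).symm⟩

theorem ccwAngle_eq_sub {a z b : Circle} (h : ccwAngle a z < ccwAngle a b) :
    ccwAngle z b = ccwAngle a b - ccwAngle a z := by
  have h1 : b = z * Circle.exp (ccwAngle a b - ccwAngle a z) := by
    rw [Circle.exp_sub, ← mul_div_assoc, eq_div_iff_mul_eq']
    conv_rhs => rw [← mul_exp_ccwAngle a z, mul_right_comm, mul_exp_ccwAngle]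
  have := ccwAngle_pos a z
  have := ccwAngle_le a b
  conv_lhs => rw [h1]
  exact ccwAngle_mul_exp z (by linarith) (by linarith)

theorem ccwAngle_eq_add {a z b : Circle} (h : ccwAngle a z + ccwAngle z b ≤ 2 * Real.pi) :
    ccwAngle a b = ccwAngle a z + ccwAngle z b := by
  have h1 : b = a * Circle.exp (ccwAngle a z + ccwAngle z b) := by
    rw [Circle.exp_add, ← mul_assoc, mul_exp_ccwAngle, mul_exp_ccwAngle]
  conv_lhs => rw [h1]
  exact ccwAngle_mul_exp a (add_pos (ccwAngle_pos _ _) (ccwAngle_pos _ _)) h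

theorem ccwAngle_swap {a b : Circle} (h : a ≠ b) :
    ccwAngle b a = 2 * Real.pi - ccwAngle a b := by
  have h0 : ccwAngle a a = 2 * Real.pi := by
    have := ccwAngle_mul_exp a Real.two_pi_pos le_rfl
    rwa [Circle.exp_two_pi, mul_one] at this
  rw [← h0]
  refine ccwAngle_eq_sub (lt_of_le_of_ne (h0 ▸ ccwAngle_le a b) fun hh => h ?_)
  exact (ccwAngle_inj hh).symm

/-- The midpoint of the counterclockwise arc from `a` to `b`. -/
noncomputable def arcMid (a b : Circle) : Circle := a * Circle.exp (ccwAngle a b / 2)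

theorem exp_half_sub (s : ℝ) :
    (Circle.exp s : ℂ) - 1 = 2 * Complex.I * (Real.sin (s / 2) : ℂ) * Circle.exp (s / 2) := by
  have h2 : (Circle.exp s : ℂ) = Circle.exp (s / 2) * Circle.exp (s / 2) := by
    rw [← Circle.coe_mul, ← Circle.exp_add, add_halves]
  have h3 : (Circle.exp (s / 2) : ℂ) = Real.cos (s / 2) + Real.sin (s / 2) * Complex.I := by
    rw [Circle.coe_exp, Complex.exp_mul_I]
    push_cast
    rfl
  have h4 : (Real.cos (s / 2) : ℂ) ^ 2 = 1 - (Real.sin (s / 2) : ℂ) ^ 2 := by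
    rw [eq_sub_iff_add_eq, add_comm]
    exact_mod_cast Real.sin_sq_add_cos_sq (s / 2)
  rw [h2, h3]
  linear_combination h4 - (Real.sin (s / 2) : ℂ) ^ 2 * Complex.I_sq

/-- The chord from `a` to `b` is a positive multiple of `i` times the midpoint of the arc. -/
theorem exists_sub_eq_arcMid {a b : Circle} (h : a ≠ b) :
    ∃ r : ℝ, 0 < r ∧ (b : ℂ) - a = Complex.I * arcMid a b * r := by
  have h1 : ccwAngle a b < 2 * Real.pi := by
    have := ccwAngle_pos b a
    rw [ccwAngle_swap h] at this
    linarith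
  refine ⟨2 * Real.sin (ccwAngle a b / 2),
    mul_pos two_pos (Real.sin_pos_of_pos_of_lt_pi ?_ ?_), ?_⟩
  · have := ccwAngle_pos a b
    linarith
  · linarith
  · conv_lhs => rw [← mul_exp_ccwAngle a b]
    rw [arcMid, Circle.coe_mul, Circle.coe_mul]
    have := exp_half_sub (ccwAngle a b)
    push_cast at this ⊢
    linear_combination (a : ℂ) * this

/-- Seen from a point `z` outside the closed arc from `a` to `b`, the product `(z - a) (z - b)` has
the direction of `-z` times the midpoint of the arc. -/
theorem exists_sub_mul_sub_eq {a b z : Circle} (hza : z ≠ a)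
    (h : ccwAngle a b < ccwAngle a z) :
    ∃ r : ℝ, 0 < r ∧ ((z : ℂ) - a) * (z - b) = -(arcMid a b : ℂ) * z * r := by
  obtain ⟨r, hr, h1⟩ := exists_sub_eq_arcMid hza.symm
  have hzb : b ≠ z := by
    rintro rfl
    exact lt_irrefl _ h
  obtain ⟨s, hs, h2⟩ := exists_sub_eq_arcMid hzb
  refine ⟨r * s, mul_pos hr hs, ?_⟩
  have h3 : arcMid a z * arcMid b z = arcMid a b * z := by
    have key : Circle.exp (ccwAngle a z / 2) * (Circle.exp (ccwAngle a b) *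
        Circle.exp ((ccwAngle a z - ccwAngle a b) / 2))
        = Circle.exp (ccwAngle a b / 2) * Circle.exp (ccwAngle a z) := by
      rw [← Circle.exp_add, ← Circle.exp_add, ← Circle.exp_add]
      congr 1
      ring
    calc arcMid a z * arcMid b z
        = a * Circle.exp (ccwAngle a z / 2) * (a * Circle.exp (ccwAngle a b) *
            Circle.exp ((ccwAngle a z - ccwAngle a b) / 2)) := by
          rw [arcMid, arcMid, ccwAngle_eq_sub h, mul_exp_ccwAngle]
      _ = a * a * (Circle.exp (ccwAngle a z / 2) * (Circle.exp (ccwAngle a b) *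
            Circle.exp ((ccwAngle a z - ccwAngle a b) / 2))) := by
          simp only [mul_assoc, mul_left_comm]
      _ = a * Circle.exp (ccwAngle a b / 2) * (a * Circle.exp (ccwAngle a z)) := by
          rw [key]
          simp only [mul_assoc, mul_left_comm]
      _ = arcMid a b * z := by rw [arcMid, mul_exp_ccwAngle]
  have h4 : (arcMid a z : ℂ) * arcMid b z = arcMid a b * z := by
    rw [← Circle.coe_mul, h3, Circle.coe_mul]
  rw [h1, h2]
  push_cast
  linear_combination (Complex.I ^ 2 * r * s) * h4 + (arcMid a b * z * r * s : ℂ) * Complex.I_sq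

/-! ### Gaps and interlacing -/

/-- `z` lies in the gap of `S` that starts at `a`: going counterclockwise from `a` one meets no
point of `S` before `z`. -/
def InGap (S : Finset Circle) (a z : Circle) : Prop :=
  ∀ y ∈ S, ccwAngle a z ≤ ccwAngle a y

theorem exists_inGap {S : Finset Circle} (hS : S.Nonempty) (z : Circle) :
    ∃ a ∈ S, InGap S a z := by
  obtain ⟨a, ha, hmin⟩ := S.exists_min_image (fun a => ccwAngle a z) hS
  refine ⟨a, ha, fun y hy => ?_⟩
  by_contra! hlt
  have h1 := hmin y hy
  rw [ccwAngle_eq_sub hlt] at h1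
  linarith [ccwAngle_pos a y]

/-- Points in the gaps starting at different points of `S` are separated by `S`. -/
theorem InGap.ccwAngle_lt {S : Finset Circle} {a a' z z' : Circle} (ha : a ∈ S) (ha' : a' ∈ S)
    (haa' : a ≠ a') (hz : InGap S a z) (hz' : InGap S a' z') (hza : z ∉ S) (hza' : z' ∉ S) :
    ccwAngle a z < ccwAngle a z' := by
  have hz'a : a' ≠ z' := fun h => hza' (h ▸ ha')
  have h1 : ccwAngle a' z' < ccwAngle a' a :=
    lt_of_le_of_ne (hz' a ha) fun h => hza' (ccwAngle_inj h ▸ ha)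
  have h2 : ccwAngle a z < ccwAngle a a' :=
    lt_of_le_of_ne (hz a' ha') fun h => hza (ccwAngle_inj h ▸ ha')
  rw [ccwAngle_swap haa'] at h1
  rw [ccwAngle_eq_add (a := a) (z := a') (b := z') (by linarith)]
  linarith [ccwAngle_pos a' z']

/-- If `Y` strictly interlaces `Z`, then every gap of `Y` contains a point of `Z`. -/
theorem StrictlyInterlaces.exists_inGap_mem {Y Z : Finset Circle} (h : StrictlyInterlaces Y Z)
    (hZ : Z.Nonempty) {y : Circle} (hy : y ∈ Y) : ∃ z ∈ Z, InGap Y y z := by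
  obtain ⟨a, ha, hamin⟩ := Z.exists_min_image (fun a => ccwAngle a y) hZ
  obtain ⟨b, hb, hbmin⟩ := Z.exists_min_image (fun b => ccwAngle y b) hZ
  have hay : a ≠ y := fun e => Finset.disjoint_left.1 h.1 hy (e ▸ ha)
  have hab : ccwAngle a b = ccwAngle a y + ccwAngle y b := by
    refine ccwAngle_eq_add ?_
    have := hbmin a ha
    rw [ccwAngle_swap hay] at this
    linarith
  have hsucc : IsCcwSucc Z a b := by
    refine ⟨ha, hb, fun z hz hzab => ?_⟩
    rw [mem_ccwArc_iff, hab] at hzab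
    rcases lt_trichotomy (ccwAngle a z) (ccwAngle a y) with hlt | heq | hlt
    · have := hamin z hz
      rw [ccwAngle_eq_sub hlt] at this
      linarith [ccwAngle_pos a z]
    · exact Finset.disjoint_left.1 h.1 hy (ccwAngle_inj heq ▸ hz)
    · have := hbmin z hz
      rw [ccwAngle_eq_sub hlt] at this
      linarith
  refine ⟨b, hb, fun y' hy' => ?_⟩
  by_contra! hlt
  have h1 : ccwAngle a y' = ccwAngle a y + ccwAngle y y' :=
    ccwAngle_eq_add (by linarith [ccwAngle_le a b])
  have := h.2 a b hsucc y hy y' hy' (mem_ccwArc_iff.2 (by linarith [ccwAngle_pos y b]))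
    (mem_ccwArc_iff.2 (by linarith))
  subst this
  linarith [ccwAngle_pos y y]

/-! ### The inner product of polynomials on the circle -/

/-- The sesquilinear form `⟨p, q⟩ = ∫ p conj(q) dμ` on polynomials. -/
noncomputable def circleInner (μ : Measure Circle) (p q : ℂ[X]) : ℂ :=
  ∫ z : Circle, p.eval (z : ℂ) * (starRingEnd ℂ) (q.eval (z : ℂ)) ∂μ

theorem continuous_eval_circle (p : ℂ[X]) : Continuous fun z : Circle => p.eval (z : ℂ) :=
  p.continuous.comp continuous_subtype_val

theorem integrable_of_continuous_circle {E : Type*} [NormedAddCommGroup E] {μ : Measure Circle}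
    [IsFiniteMeasure μ] {f : Circle → E} (hf : Continuous f) : Integrable f μ :=
  hf.integrable_of_hasCompactSupport (HasCompactSupport.of_compactSpace f)

theorem continuous_circleInner (p q : ℂ[X]) :
    Continuous fun z : Circle => p.eval (z : ℂ) * (starRingEnd ℂ) (q.eval (z : ℂ)) :=
  (continuous_eval_circle p).mul (Complex.continuous_conj.comp (continuous_eval_circle q))

theorem Circle.conj_coe_eq_inv (z : Circle) : (starRingEnd ℂ) (z : ℂ) = (z : ℂ)⁻¹ := by
  rw [← Circle.coe_inv_eq_conj, Circle.coe_inv]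

theorem circleInner_conj (μ : Measure Circle) (p q : ℂ[X]) :
    (starRingEnd ℂ) (circleInner μ p q) = circleInner μ q p := by
  rw [circleInner, ← integral_conj, circleInner]
  simp [mul_comm]

theorem circleInner_C_mul_left (μ : Measure Circle) (c : ℂ) (p q : ℂ[X]) :
    circleInner μ (C c * p) q = c * circleInner μ p q := by
  rw [circleInner, circleInner, ← integral_const_mul]
  simp [mul_assoc]

theorem circleInner_C_mul_right (μ : Measure Circle) (c : ℂ) (p q : ℂ[X]) :
    circleInner μ p (C c * q) = (starRingEnd ℂ) c * circleInner μ p q := by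
  rw [← circleInner_conj, circleInner_C_mul_left, map_mul, circleInner_conj]

theorem circleInner_X_mul_X_mul (μ : Measure Circle) (p q : ℂ[X]) :
    circleInner μ (X * p) (X * q) = circleInner μ p q := by
  rw [circleInner, circleInner]
  congr 1
  ext z
  simp only [eval_mul, eval_X, map_mul, Circle.conj_coe_eq_inv]
  field_simp [z.coe_ne_zero]

section
variable {μ : Measure Circle} [IsFiniteMeasure μ]

theorem circleInner_sum_left {ι : Type*} (s : Finset ι) (p : ι → ℂ[X]) (q : ℂ[X]) :
    circleInner μ (∑ i ∈ s, p i) q = ∑ i ∈ s, circleInner μ (p i) q := by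
  simp only [circleInner, eval_finsetSum, Finset.sum_mul]
  exact integral_finsetSum _ fun i _ =>
    integrable_of_continuous_circle (continuous_circleInner (p i) q)

theorem circleInner_sum_right {ι : Type*} (s : Finset ι) (p : ℂ[X]) (q : ι → ℂ[X]) :
    circleInner μ p (∑ i ∈ s, q i) = ∑ i ∈ s, circleInner μ p (q i) := by
  rw [← circleInner_conj, circleInner_sum_left, map_sum]
  simp only [circleInner_conj]

theorem circleInner_sub_left (p p' q : ℂ[X]) :
    circleInner μ (p - p') q = circleInner μ p q - circleInner μ p' q := by
  simp only [circleInner, eval_sub, sub_mul]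
  exact integral_sub (integrable_of_continuous_circle (continuous_circleInner p q))
    (integrable_of_continuous_circle (continuous_circleInner p' q))

theorem circleInner_sub_right (p q q' : ℂ[X]) :
    circleInner μ p (q - q') = circleInner μ p q - circleInner μ p q' := by
  rw [← circleInner_conj, circleInner_sub_left, map_sub, circleInner_conj, circleInner_conj]

theorem circleInner_eq_zero_of_monomials {p q : ℂ[X]}
    (h : ∀ j ∈ q.support, circleInner μ p (X ^ j) = 0) : circleInner μ p q = 0 := by
  rw [q.as_sum_support_C_mul_X_pow, circleInner_sum_right]
  refine Finset.sum_eq_zero fun j hj => ?_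
  rw [circleInner_C_mul_right, h j hj, mul_zero]

end

theorem circleInner_self (μ : Measure Circle) (p : ℂ[X]) :
    circleInner μ p p = ((∫ z : Circle, ‖p.eval (z : ℂ)‖ ^ 2 ∂μ : ℝ) : ℂ) := by
  rw [circleInner, ← integral_complex_ofReal]
  simp [Complex.mul_conj']

theorem finite_zeros_circle {p : ℂ[X]} (hp : p ≠ 0) : {z : Circle | p.eval (z : ℂ) = 0}.Finite := by
  refine Set.Finite.of_finite_image (f := fun z : Circle => (z : ℂ))
    (p.roots.toFinset.finite_toSet.subset ?_) Circle.coe_injective.injOn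
  rintro _ ⟨z, hz, rfl⟩
  simpa [hp] using hz

/-- A nonzero polynomial has only finitely many zeros, so it has positive norm for a measure of
infinite support. -/
theorem integral_norm_sq_eval_pos {μ : Measure Circle} [IsFiniteMeasure μ]
    (hμ : μ.support.Infinite) {p : ℂ[X]} (hp : p ≠ 0) :
    0 < ∫ z : Circle, ‖p.eval (z : ℂ)‖ ^ 2 ∂μ := by
  have hc : Continuous fun z : Circle => ‖p.eval (z : ℂ)‖ ^ 2 :=
    (continuous_eval_circle p).norm.pow 2
  refine lt_of_le_of_ne (integral_nonneg fun z => by positivity) fun h => hμ ?_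
  have h0 := (integral_eq_zero_iff_of_nonneg (fun z => by positivity)
    (integrable_of_continuous_circle hc)).1 h.symm
  refine (finite_zeros_circle hp).subset (Measure.support_subset_of_isClosed ?_ ?_)
  · exact isClosed_eq (continuous_eval_circle p) continuous_const
  · filter_upwards [h0] with z hz
    simpa using hz

theorem circleInner_self_ne_zero {μ : Measure Circle} [IsFiniteMeasure μ]
    (hμ : μ.support.Infinite) {p : ℂ[X]} (hp : p ≠ 0) : circleInner μ p p ≠ 0 := by
  rw [circleInner_self]
  exact_mod_cast (integral_norm_sq_eval_pos hμ hp).ne'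

/-! ### Quadrature -/

/-- The monic polynomial whose zeros are the points of `S`. -/
noncomputable def circleNodal (S : Finset Circle) : ℂ[X] :=
  Lagrange.nodal S fun z : Circle => (z : ℂ)

/-- The nodal polynomial of `S` is orthogonal to `z, …, z ^ (|S| - 1)`. This is the property that
characterises the zero sets of paraorthogonal polynomials. -/
def IsParaorthogonal (μ : Measure Circle) (S : Finset Circle) : Prop :=
  ∀ j, 1 ≤ j → j < S.card → circleInner μ (circleNodal S) (X ^ j) = 0

theorem IsParaorthogonal.circleInner_eq_zero {μ : Measure Circle} [IsFiniteMeasure μ]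
    {S : Finset Circle} (h : IsParaorthogonal μ S) {q : ℂ[X]} (hq : q.natDegree + 1 < S.card) :
    circleInner μ (circleNodal S) (X * q) = 0 := by
  refine circleInner_eq_zero_of_monomials fun j hj => h j ?_ ?_
  · rcases j with _ | j
    · simp at hj
    · omega
  · have := le_natDegree_of_mem_supp _ hj
    have h2 : (X * q).natDegree ≤ 1 + q.natDegree := natDegree_mul_le.trans (by simp)
    omega

/-- The fundamental Lagrange polynomials of the points of `S`. -/
noncomputable def circleBasis (S : Finset Circle) (a : Circle) : ℂ[X] :=
  Lagrange.basis S (fun z : Circle => (z : ℂ)) a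

theorem circleBasis_eq {S : Finset Circle} (a : Circle) :
    circleBasis S a = C (∏ b ∈ S.erase a, ((a : ℂ) - b)⁻¹) * circleNodal (S.erase a) := by
  rw [circleBasis, Lagrange.basis, circleNodal, Lagrange.nodal, map_prod, ← Finset.prod_mul_distrib]
  rfl

theorem circleNodal_eq_mul_erase {S : Finset Circle} {a : Circle} (ha : a ∈ S) :
    circleNodal S = (X - C (a : ℂ)) * circleNodal (S.erase a) :=
  Lagrange.nodal_eq_mul_nodal_erase ha

theorem natDegree_circleNodal (S : Finset Circle) : (circleNodal S).natDegree = S.card :=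
  Lagrange.natDegree_nodal

/-- The weights of the quadrature formula with nodes `S`. -/
noncomputable def quadratureWeight (μ : Measure Circle) (S : Finset Circle) (a : Circle) : ℝ :=
  ∫ z : Circle, ‖(circleBasis S a).eval (z : ℂ)‖ ^ 2 ∂μ

theorem circleInner_circleBasis_of_ne {μ : Measure Circle} [IsFiniteMeasure μ] {S : Finset Circle}
    (h : IsParaorthogonal μ S) {a b : Circle} (ha : a ∈ S) (hb : b ∈ S) (hab : a ≠ b) :
    circleInner μ (circleBasis S a) (circleBasis S b) = 0 := by
  rw [circleBasis_eq, circleBasis_eq, circleInner_C_mul_left, circleInner_C_mul_right]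
  have ha' : a ∈ S.erase b := Finset.mem_erase.2 ⟨hab, ha⟩
  have hcard := Finset.card_erase_of_mem ha'
  have hcard2 := Finset.card_erase_of_mem hb
  have hpos : 0 < (S.erase b).card := Finset.card_pos.2 ⟨a, ha'⟩
  set q := circleNodal ((S.erase b).erase a) with hq
  -- On the circle `conj (z - a) = -(z - a) / (a z)`, which moves the factor `z - a` to the left.
  have key : circleInner μ (circleNodal (S.erase a)) (circleNodal (S.erase b))
      = -(a : ℂ)⁻¹ * circleInner μ (circleNodal S) (X * q) := by
    rw [circleInner, circleInner, ← integral_const_mul]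
    congr 1
    ext z
    rw [circleNodal_eq_mul_erase ha, circleNodal_eq_mul_erase ha', ← hq]
    simp only [eval_mul, eval_sub, eval_X, eval_C, map_mul, map_sub, Circle.conj_coe_eq_inv]
    field_simp [z.coe_ne_zero, a.coe_ne_zero]
    ring
  rw [key, h.circleInner_eq_zero (by rw [natDegree_circleNodal]; omega)]
  simp

theorem eq_sum_circleBasis {S : Finset Circle} {p : ℂ[X]} (hp : p.natDegree < S.card) :
    p = ∑ a ∈ S, C (p.eval (a : ℂ)) * circleBasis S a := by
  have := Lagrange.eq_interpolate (f := p) (s := S) (v := fun z : Circle => (z : ℂ))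
    Circle.coe_injective.injOn (lt_of_le_of_lt degree_le_natDegree (by exact_mod_cast hp))
  rw [Lagrange.interpolate_apply] at this
  exact this

/-- The quadrature formula at the zeros of a paraorthogonal polynomial. -/
theorem IsParaorthogonal.circleInner_eq_sum {μ : Measure Circle} [IsFiniteMeasure μ]
    {S : Finset Circle} (h : IsParaorthogonal μ S) {p q : ℂ[X]} (hp : p.natDegree < S.card)
    (hq : q.natDegree < S.card) :
    circleInner μ p q = ∑ a ∈ S, (quadratureWeight μ S a : ℂ) *
      (p.eval (a : ℂ) * (starRingEnd ℂ) (q.eval (a : ℂ))) := by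
  conv_lhs => rw [eq_sum_circleBasis hp, eq_sum_circleBasis hq]
  rw [circleInner_sum_left]
  refine Finset.sum_congr rfl fun a ha => ?_
  rw [circleInner_sum_right, Finset.sum_eq_single_of_mem a ha]
  · rw [circleInner_C_mul_left, circleInner_C_mul_right, circleInner_self, quadratureWeight]
    ring
  · intro b hb hba
    rw [circleInner_C_mul_left, circleInner_C_mul_right,
      circleInner_circleBasis_of_ne h ha hb hba.symm]
    simp

theorem quadratureWeight_nonneg (μ : Measure Circle) (S : Finset Circle) (a : Circle) :
    0 ≤ quadratureWeight μ S a :=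
  integral_nonneg fun _ => by positivity

theorem quadratureWeight_pos {μ : Measure Circle} [IsFiniteMeasure μ] (hμ : μ.support.Infinite)
    {S : Finset Circle} {a : Circle} (ha : a ∈ S) : 0 < quadratureWeight μ S a :=
  integral_norm_sq_eval_pos hμ (Lagrange.basis_ne_zero Circle.coe_injective.injOn ha)

/-! ### Orthogonal and paraorthogonal polynomials -/

/-- `Φ k` is orthogonal to every polynomial of degree less than `k`. -/
theorem IsMonicOPUC.circleInner_eq_zero {ν : Measure Circle} [IsFiniteMeasure ν] {Φ : ℕ → ℂ[X]}
    (h : IsMonicOPUC ν Φ) (k : ℕ) {q : ℂ[X]} (hq : q.degree < k) : circleInner ν (Φ k) q = 0 := by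
  suffices H : ∀ d ≤ k, ∀ q : ℂ[X], q.degree < d → circleInner ν (Φ k) q = 0 from H k le_rfl q hq
  intro d
  induction d with
  | zero =>
    intro _ q hq
    have : q = 0 := by simpa using hq
    simp [this, circleInner]
  | succ d ih =>
    intro hd q hq
    -- subtracting a multiple of `Φ d` lowers the degree
    have hlow : (q - C (q.coeff d) * Φ d).degree < d := by
      rw [degree_lt_iff_coeff_zero] at hq ⊢
      intro j hj
      rcases hj.eq_or_lt with rfl | hj
      · have := (h.monic d).coeff_natDegree
        rw [h.natDegree_eq] at this
        simp [this]
      · have : (Φ d).coeff j = 0 := coeff_eq_zero_of_natDegree_lt (by rwa [h.natDegree_eq])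
        simp [this, hq j hj]
    have h1 := ih (by omega) _ hlow
    have h2 : circleInner ν (Φ k) (Φ d) = 0 := h.orthogonal k d (by omega)
    rwa [circleInner_sub_right, circleInner_C_mul_right, h2, mul_zero, sub_zero] at h1

theorem natDegree_reversedPoly_le {k : ℕ} {p : ℂ[X]} (hp : p.natDegree ≤ k) :
    (reversedPoly k p).natDegree ≤ k := by
  rw [reversedPoly, natDegree_le_iff_coeff_eq_zero]
  intro j hj
  rw [coeff_reflect, revAt_eq_self_of_lt hj]
  exact coeff_eq_zero_of_natDegree_lt (lt_of_le_of_lt (natDegree_map_le.trans hp) hj)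

theorem reversedPoly_coeff_zero (k : ℕ) (p : ℂ[X]) :
    (reversedPoly k p).coeff 0 = (starRingEnd ℂ) (p.coeff k) := by
  rw [reversedPoly, coeff_reflect, revAt_le (Nat.zero_le k), Nat.sub_zero, coeff_map]

theorem circleInner_reversedPoly (μ : Measure Circle) {k j : ℕ} (hj : j ≤ k) {p : ℂ[X]}
    (hp : p.natDegree ≤ k) :
    circleInner μ (reversedPoly k p) (X ^ j) = (starRingEnd ℂ) (circleInner μ p (X ^ (k - j))) := by
  rw [circleInner_conj, circleInner, circleInner]
  congr 1
  ext z
  have h1 : 1 / (starRingEnd ℂ) (z : ℂ) = z := by rw [Circle.conj_coe_eq_inv, one_div, inv_inv]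
  rw [reversedPoly_eval k p hp z z.coe_ne_zero, h1]
  simp only [eval_pow, eval_X, map_pow, Circle.conj_coe_eq_inv]
  rw [pow_sub₀ _ z.coe_ne_zero hj, inv_pow]
  ring

theorem IsMonicOPUC.circleInner_reversedPoly_eq_zero {ν : Measure Circle} [IsFiniteMeasure ν]
    {Φ : ℕ → ℂ[X]} (h : IsMonicOPUC ν Φ) {k j : ℕ} (h1 : 1 ≤ j) (h2 : j ≤ k) :
    circleInner ν (reversedPoly k (Φ k)) (X ^ j) = 0 := by
  rw [circleInner_reversedPoly ν h2 (h.natDegree_eq k).le, h.circleInner_eq_zero, map_zero]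
  rw [degree_X_pow]
  exact_mod_cast (by omega : k - j < k)

theorem IsMonicOPUC.circleInner_X_mul_eq_zero {ν : Measure Circle} [IsFiniteMeasure ν]
    {Φ : ℕ → ℂ[X]} (h : IsMonicOPUC ν Φ) {k j : ℕ} (h1 : 1 ≤ j) (h2 : j ≤ k) :
    circleInner ν (X * Φ k) (X ^ j) = 0 := by
  obtain ⟨i, rfl⟩ := Nat.exists_eq_add_of_le' h1
  rw [pow_succ', circleInner_X_mul_X_mul, h.circleInner_eq_zero]
  rw [degree_X_pow]
  exact_mod_cast h2

/-- The paraorthogonal polynomial of degree `l` is orthogonal to `z, …, z ^ (l - 1)`. -/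
theorem IsMonicOPUC.circleInner_popuc_eq_zero {ν : Measure Circle} [IsFiniteMeasure ν]
    {Φ : ℕ → ℂ[X]} (h : IsMonicOPUC ν Φ) (b : Circle) {l j : ℕ} (h1 : 1 ≤ j) (h2 : j < l) :
    circleInner ν (popuc Φ l b) (X ^ j) = 0 := by
  rw [popuc, circleInner_sub_left, circleInner_C_mul_left,
    h.circleInner_X_mul_eq_zero h1 (by omega), h.circleInner_reversedPoly_eq_zero h1 (by omega),
    mul_zero, sub_zero]

theorem IsMonicOPUC.popuc_monic {ν : Measure Circle} {Φ : ℕ → ℂ[X]} (h : IsMonicOPUC ν Φ)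
    (b : Circle) {l : ℕ} (hl : 1 ≤ l) : (popuc Φ l b).Monic ∧ (popuc Φ l b).natDegree = l := by
  have h1 : (X * Φ (l - 1)).natDegree = l := by
    rw [natDegree_X_mul (h.monic _).ne_zero, h.natDegree_eq]
    omega
  have hm : (X * Φ (l - 1)).Monic := monic_X.mul (h.monic _)
  have h2 : (C ((starRingEnd ℂ) (b : ℂ)) * reversedPoly (l - 1) (Φ (l - 1))).degree <
      (X * Φ (l - 1)).degree := by
    rw [degree_eq_natDegree hm.ne_zero, h1]
    refine lt_of_le_of_lt degree_le_natDegree ?_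
    have := (natDegree_C_mul_le ((starRingEnd ℂ) (b : ℂ)) (reversedPoly (l - 1) (Φ (l - 1)))).trans
      (natDegree_reversedPoly_le (h.natDegree_eq (l - 1)).le)
    exact_mod_cast (by omega)
  refine ⟨hm.sub_of_left h2, ?_⟩
  rw [popuc, natDegree_eq_of_degree_eq (degree_sub_eq_left_of_degree_lt h2), h1]

/-- A monic polynomial with as many distinct zeros on the circle as its degree is the nodal
polynomial of its zero set. -/
theorem eq_circleNodal {p : ℂ[X]} (hp : p.Monic) {S : Finset Circle} (hdeg : p.natDegree = S.card)
    (hS : ∀ z ∈ S, p.eval (z : ℂ) = 0) : p = circleNodal S := by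
  refine Polynomial.eq_of_degree_le_of_eval_index_eq S (v := fun z : Circle => (z : ℂ))
    Circle.coe_injective.injOn ?_ ?_ ?_ ?_
  · rw [degree_eq_natDegree hp.ne_zero, hdeg]
  · rw [degree_eq_natDegree hp.ne_zero, hdeg, circleNodal, Lagrange.degree_nodal]
  · rw [hp.leadingCoeff]
    exact Lagrange.nodal_monic.leadingCoeff.symm
  · intro z hz
    rw [hS z hz]
    exact (Lagrange.eval_nodal_at_node hz).symm

theorem IsMonicOPUC.isParaorthogonal {ν : Measure Circle} [IsFiniteMeasure ν] {Φ : ℕ → ℂ[X]}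
    (h : IsMonicOPUC ν Φ) {b : Circle} {S : Finset Circle} (hS : 1 ≤ S.card)
    (hz : zeroSet (popuc Φ S.card b) = (fun z : Circle => (z : ℂ)) '' (S : Set Circle)) :
    IsParaorthogonal ν S := by
  intro j h1 h2
  obtain ⟨hm, hd⟩ := h.popuc_monic b hS
  rw [← eq_circleNodal hm hd fun z hzS => ?_]
  · exact h.circleInner_popuc_eq_zero b h1 h2
  · have : (z : ℂ) ∈ zeroSet (popuc Φ S.card b) := hz ▸ ⟨z, hzS, rfl⟩
    exact this

theorem zeroSet_circleNodal (S : Finset Circle) :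
    zeroSet (circleNodal S) = (fun z : Circle => (z : ℂ)) '' (S : Set Circle) := by
  ext z
  simp [zeroSet, circleNodal, Lagrange.eval_nodal, Finset.prod_eq_zero_iff, sub_eq_zero,
    eq_comm (a := z)]

/-- The space of polynomials of degree at most `l` orthogonal to `z, …, z ^ (l - 1)` is spanned by
`z Φ_{l-1}` and `Φ_{l-1}^*`; comparing leading and constant coefficients shows that the nodal
polynomial of a set with the orthogonality property is a paraorthogonal polynomial. -/
theorem IsParaorthogonal.exists_popuc_eq {ν : Measure Circle} [IsFiniteMeasure ν]
    (hν : ν.support.Infinite) {Φ : ℕ → ℂ[X]} (h : IsMonicOPUC ν Φ) {S : Finset Circle}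
    (hS : 1 ≤ S.card) (hp : IsParaorthogonal ν S) :
    ∃ b : Circle, popuc Φ S.card b = circleNodal S := by
  obtain ⟨k, hk⟩ := Nat.exists_eq_add_of_le' hS
  set P := circleNodal S with hP
  have hPdeg : P.natDegree = k + 1 := by rw [natDegree_circleNodal, hk]
  have hPmon : P.Monic := Lagrange.nodal_monic
  have hP0 : ‖P.coeff 0‖ = 1 := by
    rw [coeff_zero_eq_eval_zero, hP, circleNodal, Lagrange.eval_nodal, norm_prod]
    exact Finset.prod_eq_one fun z _ => by simpa using z.norm_coe
  have hrevdeg := natDegree_reversedPoly_le (h.natDegree_eq k).le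
  have hrev0 : (reversedPoly k (Φ k)).coeff 0 = 1 := by
    have := (h.monic k).coeff_natDegree
    rw [h.natDegree_eq] at this
    rw [reversedPoly_coeff_zero, this, map_one]
  -- `P - P(0) Φ^*` vanishes at the origin
  obtain ⟨Q, hQ⟩ : X ∣ P - C (P.coeff 0) * reversedPoly k (Φ k) := by
    rw [X_dvd_iff]
    simp [hrev0]
  have hcoeff : ∀ j, k ≤ j → Q.coeff j = P.coeff (j + 1) := by
    intro j hj
    rw [← coeff_X_mul, ← hQ, coeff_sub, coeff_C_mul,
      coeff_eq_zero_of_natDegree_lt (lt_of_le_of_lt hrevdeg (by omega : k < j + 1)), mul_zero,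
      sub_zero]
  have hdiff : (Q - Φ k).degree < k := by
    rw [degree_lt_iff_coeff_zero]
    intro j hj
    rw [coeff_sub, hcoeff j hj]
    rcases hj.eq_or_lt with rfl | hj
    · have e1 := (h.monic k).coeff_natDegree
      have e2 := hPmon.coeff_natDegree
      rw [h.natDegree_eq] at e1
      rw [hPdeg] at e2
      rw [e1, e2, sub_self]
    · rw [coeff_eq_zero_of_natDegree_lt (by omega),
        coeff_eq_zero_of_natDegree_lt (by rw [h.natDegree_eq]; omega), sub_self]
  have horth : ∀ j < k, circleInner ν (Q - Φ k) (X ^ j) = 0 := by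
    intro j hj
    rw [circleInner_sub_left, h.circleInner_eq_zero k (by rw [degree_X_pow]; exact_mod_cast hj),
      sub_zero, ← circleInner_X_mul_X_mul, ← pow_succ', ← hQ, circleInner_sub_left,
      circleInner_C_mul_left, hp _ (by omega) (by omega),
      h.circleInner_reversedPoly_eq_zero (by omega) (by omega), mul_zero, sub_zero]
  have hzero : Q - Φ k = 0 := by
    by_contra hne
    refine circleInner_self_ne_zero hν hne (circleInner_eq_zero_of_monomials fun j hj => horth j ?_)
    exact_mod_cast lt_of_le_of_lt (le_degree_of_mem_supp j hj) hdiff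
  have hb : -(starRingEnd ℂ) (P.coeff 0) ∈ Submonoid.unitSphere ℂ := by
    rw [← SetLike.mem_coe, Submonoid.coe_unitSphere, mem_sphere_zero_iff_norm]
    simpa using hP0
  refine ⟨⟨_, hb⟩, ?_⟩
  simp only [popuc, hk, Nat.add_sub_cancel]
  rw [sub_eq_zero.1 hzero] at hQ
  rw [← hQ]
  simp

/-- Monic orthogonal polynomials by the Gram-Schmidt recursion. -/
noncomputable def monicOPUC (ν : Measure Circle) : ℕ → ℂ[X]
  | k => X ^ k - ∑ j : Fin k, C (circleInner ν (X ^ k) (monicOPUC ν j) /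
      circleInner ν (monicOPUC ν j) (monicOPUC ν j)) * monicOPUC ν j

theorem monicOPUC_monic_and_natDegree (ν : Measure Circle) (k : ℕ) :
    (monicOPUC ν k).Monic ∧ (monicOPUC ν k).natDegree = k := by
  induction k using Nat.strong_induction_on with
  | _ k ih =>
    have hlt : (∑ j : Fin k, C (circleInner ν (X ^ k) (monicOPUC ν j) /
        circleInner ν (monicOPUC ν j) (monicOPUC ν j)) * monicOPUC ν j).degree < (k : ℕ) := by
      rw [degree_lt_iff_coeff_zero]
      intro i hi
      rw [finsetSum_coeff]
      refine Finset.sum_eq_zero fun j _ => ?_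
      rw [coeff_C_mul, coeff_eq_zero_of_natDegree_lt, mul_zero]
      rw [(ih j j.2).2]
      exact j.2.trans_le hi
    rw [← degree_X_pow (R := ℂ) k] at hlt
    rw [monicOPUC]
    refine ⟨(monic_X_pow k).sub_of_left hlt, ?_⟩
    rw [natDegree_eq_of_degree_eq (degree_sub_eq_left_of_degree_lt hlt), natDegree_X_pow]

theorem isMonicOPUC_monicOPUC {ν : Measure Circle} [IsFiniteMeasure ν] (hν : ν.support.Infinite) :
    IsMonicOPUC ν (monicOPUC ν) := by
  have hlt : ∀ k, ∀ j < k, circleInner ν (monicOPUC ν k) (monicOPUC ν j) = 0 := by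
    intro k
    induction k using Nat.strong_induction_on with
    | _ k ih =>
      intro j hj
      have hself := circleInner_self_ne_zero hν (monicOPUC_monic_and_natDegree ν j).1.ne_zero
      rw [monicOPUC, circleInner_sub_left, circleInner_sum_left,
        Finset.sum_eq_single_of_mem (⟨j, hj⟩ : Fin k) (Finset.mem_univ _), circleInner_C_mul_left,
        div_mul_cancel₀ _ hself, sub_self]
      intro i _ hij
      have hij' : (i : ℕ) ≠ j := fun e => hij (Fin.ext e)
      rw [circleInner_C_mul_left]
      rcases lt_or_gt_of_ne hij' with hlt | hlt
      · rw [← circleInner_conj ν (monicOPUC ν j), ih j hj i hlt, map_zero, mul_zero]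
      · rw [ih i i.2 j hlt, mul_zero]
  refine ⟨fun k => (monicOPUC_monic_and_natDegree ν k).1,
    fun k => (monicOPUC_monic_and_natDegree ν k).2, fun j k hjk => ?_⟩
  change circleInner ν _ _ = 0
  rcases lt_or_gt_of_ne hjk with h | h
  · rw [← circleInner_conj, hlt k j h, map_zero]
  · exact hlt j k h

/-! ### Necessity of interlacing -/

theorem IsParaorthogonal.strictlyInterlaces {ν : Measure Circle} [IsFiniteMeasure ν]
    (hν : ν.support.Infinite) {Y Z : Finset Circle} (hY : IsParaorthogonal ν Y)
    (hZ : IsParaorthogonal ν Z) (hcard : Y.card < Z.card) (hdisj : Disjoint Y Z) :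
    StrictlyInterlaces Y Z := by
  refine ⟨hdisj, fun a b hab => ?_⟩
  suffices H : ∀ y ∈ Y, ∀ y' ∈ Y, y' ∈ ccwArc a b → ¬ ccwAngle a y < ccwAngle a y' by
    intro y hy y' hy' hyab hyab'
    exact ccwAngle_inj (le_antisymm (not_lt.1 (H y' hy' y hy hyab)) (not_lt.1 (H y hy y' hy' hyab')))
  intro y hy y' hy' hyab' hlt
  have hne : y ≠ y' := fun e => by simp [e] at hlt
  rw [mem_ccwArc_iff] at hyab'
  have hy'm : y' ∈ Y.erase y := Finset.mem_erase.2 ⟨hne.symm, hy'⟩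
  have hc1 := Finset.card_erase_of_mem hy'm
  have hc2 := Finset.card_erase_of_mem hy
  have hc3 : 0 < (Y.erase y).card := Finset.card_pos.2 ⟨y', hy'm⟩
  set q := circleNodal ((Y.erase y).erase y') with hq
  have hqdeg : q.natDegree = Y.card - 2 := by
    rw [natDegree_circleNodal]
    omega
  have h0 : circleInner ν (circleNodal Y) (X * q) = 0 := hY.circleInner_eq_zero (by omega)
  have hXq : (X * q).natDegree < Z.card := by
    have h2 : (X * q).natDegree ≤ 1 + q.natDegree := natDegree_mul_le.trans (by simp)
    omega
  rw [hZ.circleInner_eq_sum (by rwa [natDegree_circleNodal]) hXq] at h0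
  -- every term of the quadrature sum is a positive multiple of the same number
  have hterm : ∀ z ∈ Z, ∃ r : ℝ, 0 < r ∧ (quadratureWeight ν Z z : ℂ) *
      ((circleNodal Y).eval (z : ℂ) * (starRingEnd ℂ) ((X * q).eval (z : ℂ)))
        = -(arcMid y y' : ℂ) * r := by
    intro z hz
    have hzY : z ∉ Y := fun hzY => Finset.disjoint_left.1 hdisj hzY hz
    have hzy : z ≠ y := fun e => hzY (e ▸ hy)
    have hz1 : ccwAngle a b ≤ ccwAngle a z := by
      have := hab.2.2 z hz
      rwa [mem_ccwArc_iff, not_lt] at this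
    have hz2 : ccwAngle y y' < ccwAngle y z := by
      rw [ccwAngle_eq_sub hlt, ccwAngle_eq_sub (hlt.trans (hyab'.trans_le hz1))]
      linarith
    obtain ⟨r, hr, hr2⟩ := exists_sub_mul_sub_eq hzy hz2
    have hqz : q.eval (z : ℂ) ≠ 0 := by
      refine Lagrange.eval_nodal_not_at_node fun i hi e => hzY ?_
      rw [Circle.coe_injective e]
      exact Finset.mem_of_mem_erase (Finset.mem_of_mem_erase hi)
    refine ⟨quadratureWeight ν Z z * (r * ‖q.eval (z : ℂ)‖ ^ 2),
      mul_pos (quadratureWeight_pos hν hz) (by positivity), ?_⟩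
    rw [circleNodal_eq_mul_erase hy, circleNodal_eq_mul_erase hy'm, ← hq]
    simp only [eval_mul, eval_sub, eval_X, eval_C, map_mul, Circle.conj_coe_eq_inv]
    have hn := Complex.mul_conj' (q.eval (z : ℂ))
    have hzz := mul_inv_cancel₀ z.coe_ne_zero
    push_cast
    rw [← hn, ← mul_assoc ((z : ℂ) - y), hr2]
    linear_combination (-(quadratureWeight ν Z z : ℂ) * arcMid y y' * r * q.eval (z : ℂ) *
      (starRingEnd ℂ) (q.eval (z : ℂ))) * hzz
  choose! r hr hr2 using hterm
  rw [Finset.sum_congr rfl hr2, ← Finset.mul_sum, mul_eq_zero, neg_eq_zero] at h0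
  have h1 := h0.resolve_left (Circle.coe_ne_zero _)
  have h2 : 0 < ∑ z ∈ Z, r z := Finset.sum_pos hr ⟨a, hab.1⟩
  rw [← Complex.ofReal_sum] at h1
  exact h2.ne' (by exact_mod_cast h1)

/-! ### Discrete measures annihilating a nodal polynomial -/

/-- If `η a` lies in the gap of `S` starting at `a`, for every `a ∈ S`, then there are positive
weights at the points `η a` for which the nodal polynomial of `S` is orthogonal to
`z, …, z ^ (|S| - 1)`. They come from the vanishing of the divided difference at the points `η a` of
a polynomial of degree at most `|S| - 2`; positivity holds because the factors belonging to `b ≠ a`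
can be paired as in `exists_sub_mul_sub_eq`. -/
theorem exists_pos_weights {S : Finset Circle} {η : Circle → Circle} (hηS : ∀ a ∈ S, η a ∉ S)
    (hgap : ∀ a ∈ S, InGap S a (η a)) :
    ∃ w : Circle → ℝ, (∀ a ∈ S, 0 < w a) ∧ ∀ j, 1 ≤ j → j < S.card →
      ∑ a ∈ S, (w a : ℂ) * ((circleNodal S).eval (η a : ℂ) *
        (starRingEnd ℂ) ((X ^ j : ℂ[X]).eval (η a : ℂ))) = 0 := by
  have hlt : ∀ a ∈ S, ∀ b ∈ S, b ≠ a → ccwAngle b (η b) < ccwAngle b (η a) := fun a ha b hb hba =>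
    (hgap b hb).ccwAngle_lt hb ha hba (hgap a ha) (hηS b hb) (hηS a ha)
  have hne : ∀ a ∈ S, ∀ b ∈ S, η a ≠ b := fun a ha b hb e => hηS a ha (e ▸ hb)
  have hinj : Set.InjOn (fun a => (η a : ℂ)) S := by
    intro a ha b hb hab
    by_contra hc
    have := hlt b hb a ha hc
    rw [Circle.coe_injective hab] at this
    exact lt_irrefl _ this
  -- the chord from `a` to `η a`
  have hr : ∀ a ∈ S, ∃ r : ℝ, 0 < r ∧ (η a : ℂ) - a = Complex.I * arcMid a (η a) * r :=
    fun a ha => exists_sub_eq_arcMid (hne a ha a ha).symm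
  choose! r hr0 hr using hr
  have hs : ∀ a ∈ S, ∀ b ∈ S, b ≠ a → ∃ s : ℝ, 0 < s ∧
      ((η a : ℂ) - b) * (η a - η b) = -(arcMid b (η b) : ℂ) * η a * s :=
    fun a ha b hb hba => exists_sub_mul_sub_eq (hne a ha b hb) (hlt a ha b hb hba)
  choose! s hs0 hs using hs
  have hprod : ∀ a ∈ S, 0 < r a * ∏ b ∈ S.erase a, s a b := fun a ha =>
    mul_pos (hr0 a ha) (Finset.prod_pos fun b hb =>
      hs0 a ha b (Finset.mem_of_mem_erase hb) (Finset.ne_of_mem_erase hb))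
  refine ⟨fun a => (r a * ∏ b ∈ S.erase a, s a b)⁻¹, fun a ha => inv_pos.2 (hprod a ha),
    fun j hj1 hj2 => ?_⟩
  set K : ℂ := Complex.I * (-1) ^ (S.card - 1) * ∏ b ∈ S, (arcMid b (η b) : ℂ) with hK
  have hkey : ∀ a ∈ S, (circleNodal S).eval (η a : ℂ) * ∏ b ∈ S.erase a, ((η a : ℂ) - η b)
      = K * (η a : ℂ) ^ (S.card - 1) * ((r a * ∏ b ∈ S.erase a, s a b : ℝ) : ℂ) := by
    intro a ha
    rw [circleNodal_eq_mul_erase ha, eval_mul, circleNodal, Lagrange.eval_nodal, mul_assoc,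
      ← Finset.prod_mul_distrib, Finset.prod_congr rfl fun b hb =>
        hs a ha b (Finset.mem_of_mem_erase hb) (Finset.ne_of_mem_erase hb),
      Finset.prod_mul_distrib, Finset.prod_mul_distrib, Finset.prod_const,
      Finset.card_erase_of_mem ha, Finset.prod_neg, Finset.card_erase_of_mem ha, hK,
      ← Finset.mul_prod_erase S _ ha]
    simp only [eval_sub, eval_X, eval_C, hr a ha]
    push_cast
    ring
  have hdd : ∑ a ∈ S, ((X ^ (S.card - 1 - j) : ℂ[X]).eval (η a : ℂ)) /
      ∏ b ∈ S.erase a, ((η a : ℂ) - η b) = 0 := by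
    rw [← Lagrange.coeff_eq_sum (v := fun a => (η a : ℂ)) hinj, coeff_X_pow, if_neg (by omega)]
    rw [degree_X_pow]
    exact_mod_cast (by omega : S.card - 1 - j < S.card)
  rw [← mul_zero K, ← hdd, Finset.mul_sum]
  refine Finset.sum_congr rfl fun a ha => ?_
  have h1 : ∏ b ∈ S.erase a, ((η a : ℂ) - η b) ≠ 0 := Finset.prod_ne_zero_iff.2 fun b hb e =>
    Finset.ne_of_mem_erase hb (hinj (Finset.mem_of_mem_erase hb) ha (sub_eq_zero.1 e).symm)
  have h2 : ((r a * ∏ b ∈ S.erase a, s a b : ℝ) : ℂ) ≠ 0 := by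
    exact_mod_cast (hprod a ha).ne'
  have h3 : (η a : ℂ) ^ (S.card - 1) = (η a : ℂ) ^ (S.card - 1 - j) * (η a : ℂ) ^ j := by
    rw [← pow_add]
    congr 1
    omega
  have h4 : (circleNodal S).eval (η a : ℂ) = K * (η a : ℂ) ^ (S.card - 1) *
      ((r a * ∏ b ∈ S.erase a, s a b : ℝ) : ℂ) / ∏ b ∈ S.erase a, ((η a : ℂ) - η b) := by
    rw [eq_div_iff h1, hkey a ha]
  rw [h4, h3]
  simp only [eval_pow, eval_X, map_pow, Circle.conj_coe_eq_inv, Complex.ofReal_inv, inv_pow]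
  have := (η a).coe_ne_zero
  field_simp

/-- The discrete measure with mass `w a` at `η a`, for `a ∈ S`. -/
noncomputable def discreteMeasure (S : Finset Circle) (w : Circle → ℝ) (η : Circle → Circle) :
    Measure Circle :=
  ∑ a ∈ S, ENNReal.ofReal (w a) • Measure.dirac (η a)

instance (S : Finset Circle) (w : Circle → ℝ) (η : Circle → Circle) :
    IsFiniteMeasure (discreteMeasure S w η) := by
  refine ⟨?_⟩
  simp [discreteMeasure]

theorem integral_discreteMeasure {S : Finset Circle} {w : Circle → ℝ} (hw : ∀ a ∈ S, 0 ≤ w a)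
    (η : Circle → Circle) (f : Circle → ℂ) :
    ∫ z, f z ∂(discreteMeasure S w η) = ∑ a ∈ S, (w a : ℂ) * f (η a) := by
  rw [discreteMeasure, integral_finsetSum_measure]
  · refine Finset.sum_congr rfl fun a ha => ?_
    rw [integral_smul_measure, integral_dirac, ENNReal.toReal_ofReal (hw a ha),
      Complex.real_smul]
  · intro a _
    exact (integrable_dirac (by simp)).smul_measure ENNReal.ofReal_ne_top

theorem mem_support_of_measure_singleton_ne_zero {X : Type*} [TopologicalSpace X]
    [MeasurableSpace X] {μ : Measure X} {x : X} (h : μ {x} ≠ 0) : x ∈ μ.support :=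
  (Measure.mem_support_iff_forall x).2 fun _ hU =>
    (pos_iff_ne_zero.2 h).trans_le (measure_mono (Set.singleton_subset_iff.2 (mem_of_mem_nhds hU)))

theorem discreteMeasure_singleton_ne_zero {S : Finset Circle} {w : Circle → ℝ}
    {η : Circle → Circle} {a : Circle} (ha : a ∈ S) (hw : 0 < w a) :
    discreteMeasure S w η {η a} ≠ 0 := by
  rw [discreteMeasure, Measure.finsetSum_apply]
  intro h
  have := (Finset.sum_eq_zero_iff.1 h) a ha
  simp [hw.not_ge] at this

/-- Weights on `Z`, one for each point, making the nodal polynomial of an interlacing set `Y`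
orthogonal to `z, …, z ^ (|Y| - 1)`. Each point of `Z` belongs to a choice of one point of `Z` from
every gap of `Y`; the weights belonging to all these choices are added up. -/
theorem StrictlyInterlaces.exists_pos_weights {Y Z : Finset Circle} (h : StrictlyInterlaces Y Z)
    (hY : Y.Nonempty) :
    ∃ w : Circle → ℝ, (∀ z ∈ Z, 0 < w z) ∧ ∀ j, 1 ≤ j → j < Y.card →
      ∑ z ∈ Z, (w z : ℂ) * ((circleNodal Y).eval (z : ℂ) *
        (starRingEnd ℂ) ((X ^ j : ℂ[X]).eval (z : ℂ))) = 0 := by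
  have hZY : ∀ z ∈ Z, z ∉ Y := fun z hz hzY => Finset.disjoint_left.1 h.1 hzY hz
  -- for each `c ∈ Z` nonnegative weights that are positive at `c`
  have hone : ∀ c ∈ Z, ∃ w : Circle → ℝ, (∀ z ∈ Z, 0 ≤ w z) ∧ 0 < w c ∧ ∀ j, 1 ≤ j → j < Y.card →
      ∑ z ∈ Z, (w z : ℂ) * ((circleNodal Y).eval (z : ℂ) *
        (starRingEnd ℂ) ((X ^ j : ℂ[X]).eval (z : ℂ))) = 0 := by
    intro c hc
    have hg : ∀ y ∈ Y, ∃ z ∈ Z, InGap Y y z := fun y hy => h.exists_inGap_mem ⟨c, hc⟩ hy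
    choose! g hgZ hg using hg
    obtain ⟨y₀, hy₀, hy₀c⟩ := exists_inGap hY c
    set η := Function.update g y₀ c with hη
    have hηZ : ∀ y ∈ Y, η y ∈ Z := by
      intro y hy
      by_cases e : y = y₀
      · simpa [hη, e] using hc
      · simpa [hη, e] using hgZ y hy
    have hηg : ∀ y ∈ Y, InGap Y y (η y) := by
      intro y hy
      by_cases e : y = y₀
      · simpa [hη, e] using hy₀c
      · simpa [hη, e] using hg y hy
    obtain ⟨v, hv, hv0⟩ := _root_.exists_pos_weights (fun y hy => hZY _ (hηZ y hy)) hηg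
    refine ⟨fun z => ∑ y ∈ Y with η y = z, v y, fun z _ => Finset.sum_nonneg fun y hy =>
      (hv y (Finset.mem_filter.1 hy).1).le, Finset.sum_pos (fun y hy =>
      hv y (Finset.mem_filter.1 hy).1) ⟨y₀, by simp [hη, hy₀]⟩, fun j hj1 hj2 => ?_⟩
    rw [← hv0 j hj1 hj2, ← Finset.sum_fiberwise_of_maps_to hηZ]
    refine Finset.sum_congr rfl fun z _ => ?_
    push_cast
    rw [Finset.sum_mul]
    refine Finset.sum_congr rfl fun y hy => ?_
    rw [(Finset.mem_filter.1 hy).2]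
  choose! w hw0 hwpos hw using hone
  refine ⟨fun z => ∑ c ∈ Z, w c z, fun z hz => Finset.sum_pos' (fun c hc => hw0 c hc z hz)
    ⟨z, hz, hwpos z hz⟩, fun j hj1 hj2 => ?_⟩
  push_cast
  simp only [Finset.sum_mul]
  rw [Finset.sum_comm]
  exact Finset.sum_eq_zero fun c hc => hw c hc j hj1 hj2

/-! ### Sufficiency of interlacing -/

theorem circleInner_discreteMeasure {S : Finset Circle} {w : Circle → ℝ} (hw : ∀ a ∈ S, 0 ≤ w a)
    (η : Circle → Circle) (p q : ℂ[X]) :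
    circleInner (discreteMeasure S w η) p q = ∑ a ∈ S, (w a : ℂ) *
      (p.eval (η a : ℂ) * (starRingEnd ℂ) (q.eval (η a : ℂ))) :=
  integral_discreteMeasure hw η _

/-- Every nonempty finite set has the orthogonality property for some finite measure of infinite
support. The measure is a sum of discrete ones, each carried by a copy of the set turned by a small
angle. -/
theorem exists_isParaorthogonal {S : Finset Circle} (hS : S.Nonempty) :
    ∃ σ : Measure Circle, IsFiniteMeasure σ ∧ σ.support.Infinite ∧ IsParaorthogonal σ S := by
  obtain ⟨δ, hδ0, hδ⟩ : ∃ δ : ℝ, 0 < δ ∧ ∀ a ∈ S, ∀ b ∈ S, δ ≤ ccwAngle a b := by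
    obtain ⟨x, _, hx⟩ := (S ×ˢ S).exists_min_image (fun x => ccwAngle x.1 x.2) (hS.product hS)
    exact ⟨_, ccwAngle_pos x.1 x.2, fun a ha b hb => hx (a, b) (Finset.mk_mem_product ha hb)⟩
  obtain ⟨a₀, ha₀⟩ := hS
  set t : ℕ → ℝ := fun k => δ / (k + 2) with ht
  have ht0 : ∀ k, 0 < t k := fun k => by positivity
  have htδ : ∀ k, t k < δ := fun k => by
    rw [ht, div_lt_iff₀ (by positivity)]
    nlinarith [(Nat.cast_nonneg k : (0 : ℝ) ≤ k)]
  have hangle : ∀ k, ∀ a : Circle, ccwAngle a (a * Circle.exp (t k)) = t k := fun k a =>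
    ccwAngle_mul_exp a (ht0 k)
      ((htδ k).le.trans ((hδ a₀ ha₀ a₀ ha₀).trans (ccwAngle_le a₀ a₀)))
  have hw : ∀ k, ∃ w : Circle → ℝ, (∀ a ∈ S, 0 < w a) ∧ ∀ j, 1 ≤ j → j < S.card →
      ∑ a ∈ S, (w a : ℂ) * ((circleNodal S).eval ((a * Circle.exp (t k) : Circle) : ℂ) *
        (starRingEnd ℂ) ((X ^ j : ℂ[X]).eval ((a * Circle.exp (t k) : Circle) : ℂ))) = 0 := by
    intro k
    refine exists_pos_weights (η := fun a => a * Circle.exp (t k)) (fun a ha hmem => ?_)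
      fun a ha b hb => ?_
    · have := hδ a ha _ hmem
      rw [hangle] at this
      exact absurd (htδ k) this.not_gt
    · rw [hangle]
      exact (htδ k).le.trans (hδ a ha b hb)
  choose w hw0 hw using hw
  have hsum : ∀ k, 0 < ∑ a ∈ S, w k a := fun k => Finset.sum_pos (hw0 k) ⟨a₀, ha₀⟩
  -- the `k`-th summand is normalised to have mass `2 ^ (-k)`
  set c : ℕ → ℝ := fun k => (1 / 2) ^ k / ∑ a ∈ S, w k a with hc
  have hc0 : ∀ k, 0 < c k := fun k => div_pos (by positivity) (hsum k)
  have hcw0 : ∀ k, ∀ a ∈ S, 0 < c k * w k a := fun k a ha => mul_pos (hc0 k) (hw0 k a ha)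
  set μ : ℕ → Measure Circle := fun k =>
    discreteMeasure S (fun a => c k * w k a) (fun a => a * Circle.exp (t k)) with hμ
  have hmass : ∀ k, μ k Set.univ = ENNReal.ofReal ((1 / 2) ^ k) := by
    intro k
    simp only [hμ, discreteMeasure, Measure.finsetSum_apply]
    simp only [Measure.smul_apply, measure_univ, smul_eq_mul, mul_one]
    rw [← ENNReal.ofReal_sum_of_nonneg fun a ha => (hcw0 k a ha).le, ← Finset.mul_sum, hc,
      div_mul_cancel₀ _ (hsum k).ne']
  have hfin : IsFiniteMeasure (Measure.sum μ) := by
    refine ⟨?_⟩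
    rw [Measure.sum_apply _ MeasurableSet.univ]
    simp only [hmass]
    exact summable_geometric_two.tsum_ofReal_lt_top
  refine ⟨Measure.sum μ, hfin, ?_, fun j hj1 hj2 => ?_⟩
  · refine Set.infinite_of_injective_forall_mem (f := fun k : ℕ => a₀ * Circle.exp (t k)) ?_ ?_
    · intro k l hkl
      have h1 : t k = t l := by
        have := congrArg (ccwAngle a₀) hkl
        simpa only [hangle] using this
      rw [ht] at h1
      simp only at h1
      field_simp at h1
      have h2 : (l : ℝ) = k := by linarith
      exact_mod_cast h2.symm
    · intro k
      refine mem_support_of_measure_singleton_ne_zero fun h => ?_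
      have h1 : μ k {a₀ * Circle.exp (t k)} ≤ 0 := h ▸ Measure.le_iff'.1 (Measure.le_sum μ k) _
      exact discreteMeasure_singleton_ne_zero (η := fun a => a * Circle.exp (t k)) ha₀
        (hcw0 k a₀ ha₀) (le_antisymm h1 bot_le)
  · have h1 := hasSum_integral_measure (integrable_of_continuous_circle (μ := Measure.sum μ)
      (continuous_circleInner (circleNodal S) (X ^ j)))
    have h2 : ∀ k, circleInner (μ k) (circleNodal S) (X ^ j) = 0 := by
      intro k
      rw [hμ, circleInner_discreteMeasure fun a ha => (hcw0 k a ha).le,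
        ← mul_zero (c k : ℂ), ← hw k j hj1 hj2, Finset.mul_sum]
      refine Finset.sum_congr rfl fun a _ => ?_
      push_cast
      ring
    refine h1.unique ?_
    convert! (hasSum_zero : HasSum (fun _ : ℕ => (0 : ℂ)) 0) using 1
    exact funext h2

/-- The measure is `σ + ∑ (c w z - v z) δ_z` over `z ∈ Z`, where `σ` has infinite support and the
orthogonality property for `Z`, the `v z` are its quadrature weights and the `w z` are weights on
`Z` with the orthogonality property for `Y`. By the quadrature formula `σ` and `∑ v z δ_z` cancel on
the polynomials in question. -/
theorem StrictlyInterlaces.exists_isParaorthogonal {Y Z : Finset Circle}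
    (h : StrictlyInterlaces Y Z) (hY : Y.Nonempty) (hcard : Y.card < Z.card) :
    ∃ ν : Measure Circle, IsFiniteMeasure ν ∧ ν.support.Infinite ∧ IsParaorthogonal ν Z ∧
      IsParaorthogonal ν Y := by
  obtain ⟨σ, hσfin, hσinf, hσ⟩ := _root_.exists_isParaorthogonal
    (Finset.card_pos.1 (by omega) : Z.Nonempty)
  obtain ⟨w, hw0, hw⟩ := h.exists_pos_weights hY
  set v := quadratureWeight σ Z with hv
  have hv0 : ∀ z, 0 ≤ v z := quadratureWeight_nonneg σ Z
  set c : ℝ := ∑ z ∈ Z, v z / w z with hc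
  have hcw : ∀ z ∈ Z, 0 ≤ c * w z - v z := by
    intro z hz
    have h1 : v z / w z ≤ c := Finset.single_le_sum (f := fun z => v z / w z)
      (fun y hy => div_nonneg (hv0 y) (hw0 y hy).le) hz
    rw [div_le_iff₀ (hw0 z hz)] at h1
    linarith
  have hinner : ∀ p q, circleInner (σ + discreteMeasure Z (fun z => c * w z - v z) id) p q =
      circleInner σ p q + ∑ z ∈ Z, ((c * w z - v z : ℝ) : ℂ) *
        (p.eval (z : ℂ) * (starRingEnd ℂ) (q.eval (z : ℂ))) := by
    intro p q
    rw [circleInner, integral_add_measure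
      (integrable_of_continuous_circle (continuous_circleInner p q))
      (integrable_of_continuous_circle (continuous_circleInner p q)),
      integral_discreteMeasure hcw]
    rfl
  refine ⟨σ + discreteMeasure Z (fun z => c * w z - v z) id, inferInstance, ?_, ?_, ?_⟩
  · rw [Measure.support_add]
    exact hσinf.mono Set.subset_union_left
  · intro j hj1 hj2
    rw [hinner, hσ j hj1 hj2, zero_add]
    refine Finset.sum_eq_zero fun z hz => ?_
    have : (circleNodal Z).eval (z : ℂ) = 0 := Lagrange.eval_nodal_at_node hz
    rw [this, zero_mul, mul_zero]
  · intro j hj1 hj2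
    rw [hinner, hσ.circleInner_eq_sum (by rwa [natDegree_circleNodal])
      (by rw [natDegree_X_pow]; omega), ← Finset.sum_add_distrib, ← mul_zero (c : ℂ),
      ← hw j hj1 hj2, Finset.mul_sum]
    refine Finset.sum_congr rfl fun z _ => ?_
    rw [← hv]
    push_cast
    ring

theorem mainTheorem5 (m n : ℕ) (hm : 1 ≤ m) (hmn : m < n) (Zn Zm : Finset Circle)
    (hZn : Zn.card = n) (hZm : Zm.card = m) (hdisj : Disjoint Zm Zn) :
    (∃ (ν : Measure Circle) (Φ : ℕ → ℂ[X]) (bn bm : Circle),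
      IsFiniteMeasure ν ∧ ν.support.Infinite ∧ IsMonicOPUC ν Φ ∧
      zeroSet (popuc Φ n bn) = (fun z : Circle => (z : ℂ)) '' (Zn : Set Circle) ∧
      zeroSet (popuc Φ m bm) = (fun z : Circle => (z : ℂ)) '' (Zm : Set Circle)) ↔
    StrictlyInterlaces Zm Zn := by
  subst hZn hZm
  constructor
  · rintro ⟨ν, Φ, bn, bm, hfin, hinf, hΦ, hn, hm'⟩
    exact (hΦ.isParaorthogonal hm hm').strictlyInterlaces hinf
      (hΦ.isParaorthogonal (hm.trans hmn.le) hn) hmn hdisj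
  · intro h
    obtain ⟨ν, hfin, hinf, hn, hm'⟩ := h.exists_isParaorthogonal (Finset.card_pos.1 hm) hmn
    have hΦ := isMonicOPUC_monicOPUC hinf
    obtain ⟨bn, hbn⟩ := hn.exists_popuc_eq hinf hΦ (hm.trans hmn.le)
    obtain ⟨bm, hbm⟩ := hm'.exists_popuc_eq hinf hΦ hm
    exact ⟨ν, monicOPUC ν, bn, bm, hfin, hinf, hΦ, hbn ▸ zeroSet_circleNodal Zn,
      hbm ▸ zeroSet_circleNodal Zm⟩
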